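/- Let $f_1,\dots,f_s,h\in\mathbb R[x_1,\dots,x_n]$ and let $e\in(\mathbb R\setminus\{0\})^s$. For $e'\in\mathbb R^s$ put $$S_{e'}=\{x\in\mathbb R^n : |f_i(x)|\le |e'_i|\text{ for }1\le i\le s\}.$$ For $I\subseteq\{1,\dots,s\}$ and $\sigma:I\to\{\pm1\}$ let $$A_{I,\sigma,e'}=\{x\in\mathbb R^n : f_i(x)=\sigma_ie'_i\text{ for } i\in I,\ |f_i(x)|<|e'_i|\text{ for } i\notin I\},$$ let $A^{\mathrm{reg}}_{I,\sigma,e'}$ be the set of $x\in A_{I,\sigma,e'}$ at which the differentials $\mathrm d_xf_i$, $i\in I$, are linearly independent, and let $\operatorname{crit}(h,A^{\mathrm{reg}}_{I,\sigma,e'})$ be the set of $x\in A^{\mathrm{reg}}_{I,\sigma,e'}$ at which $\mathrm d_xh$ vanishes on the tangent space $\bigcap_{i\in I}\ker \mathrm d_xf_i$. Put $$\Sigma_{e'}=\bigcup_{I,\sigma}h\big(\operatorname{crit}(h,A^{\mathrm{reg}}_{I,\sigma,e'})\big),\qquad \lim_{r\to0}\Sigma_{re}=\bigcap_{R>0}\overline{\bigcup_{0<r<R}\Sigma_{re}},$$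 where the bar denotes the Euclidean closure. The algorithm LimitCriticalValues, on input $f_1,\dots,f_s,h,e$, starts with $Z=\varnothing$ and does the following for each pair $(I,\sigma)$ with $I\subseteq\{1,\dots,s\}$, $\#I\le n$ and $\sigma:I\to\{\pm1\}$. It forms the ideal $$J'=\Big\langle \sum_{i\in I}\lambda_i\,\partial_jf_i-\partial_jh\Big\rangle_{1\le j\le n}+\big\langle \sigma_je_jf_i-\sigma_ie_if_j\big\rangle_{i,j\in I}$$ of $\mathbb R[x_1,\dots,x_n,(\lambda_i)_{i\in I}]$, where the $\lambda_i$ are new variables; it forms the ideal $J=J'\cap\mathbb R[x_1,\dots,x_n]+\langle f_1,\dots,f_s\rangle$ of $\mathbb R[x_1,\dots,x_n]$; it takes a generator $p$ of the ideal $(J+\langle h-t\rangle)\cap\mathbb R[t]$, where $t$ is a new variable; and it replaces $Z$ by $Z\cup\{t\in\mathbb R : p(t)=0\}$. At the end it returns $Z$. Assume that the restriction of $h$ to $S_e$ is proper. Then the algorithm returns a set $Z\subset\mathbb R$, and, whatever generators $p$ are chosen, the returned set $Z$ is finite and contains $\lim_{r\to0}\Sigma_{re}$. -/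

import Mathlib

open MvPolynomial

namespace LimitCrit

variable {n s : ℕ}

/-! ### Geometry: the sets `S_e`, their strata and the critical values of `h` -/

/-- The polynomial map `F = (f₁, …, f_s) : ℝⁿ → ℝˢ`. -/
noncomputable def polyMap (f : Fin s → MvPolynomial (Fin n) ℝ) (x : Fin n → ℝ) : Fin s → ℝ :=
  fun i => eval x (f i)

/-- `S_e = {x ∈ ℝⁿ | |f_i(x)| ≤ |e_i| for all i}`. -/
def setS (f : Fin s → MvPolynomial (Fin n) ℝ) (e : Fin s → ℝ) : Set (Fin n → ℝ) :=
  {x | ∀ i, |polyMap f x i| ≤ |e i|}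

/-- The pairs `(I, σ)` with `I ⊆ {1, …, s}` and `σ : I → {±1}`. -/
abbrev FaceIndex (s : ℕ) : Type := Σ I : Finset (Fin s), (I → ℤˣ)

/-- The sign `σ_i ∈ {±1}` as a real number. -/
def FaceIndex.sign (k : FaceIndex s) (i : k.1) : ℝ := ((k.2 i : ℤ) : ℝ)

/-- The relatively open face of the hypercube `∏ [-|e_i|, |e_i|]` given by `(I, σ)`: the factor of
index `i` is the point `σ_i e_i` if `i ∈ I`, and the open interval between `-e_i` and `e_i` if
`i ∉ I`. -/
def cubeFace (e : Fin s → ℝ) (k : FaceIndex s) : Set (Fin s → ℝ) :=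
  {y | (∀ i : k.1, y i = k.sign i * e i) ∧ ∀ i, i ∉ k.1 → |y i| < |e i|}

/-- The stratum of `S_e` given by `(I, σ)`, the preimage under `F` of a face of the hypercube. -/
def stratum (f : Fin s → MvPolynomial (Fin n) ℝ) (e : Fin s → ℝ) (k : FaceIndex s) :
    Set (Fin n → ℝ) :=
  polyMap f ⁻¹' cubeFace e k

/-- The differential `d_x g : ℝⁿ → ℝ` of a polynomial function `g`. -/
noncomputable def differential (g : MvPolynomial (Fin n) ℝ) (x : Fin n → ℝ) :
    (Fin n → ℝ) →ₗ[ℝ] ℝ :=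
  ∑ j, eval x (pderiv j g) • LinearMap.proj j

/-- The regular locus of the stratum given by `(I, σ)`: the points where the differentials of the
defining equations, i.e. of the `f_i` with `i ∈ I`, are linearly independent. -/
def regStratum (f : Fin s → MvPolynomial (Fin n) ℝ) (e : Fin s → ℝ) (k : FaceIndex s) :
    Set (Fin n → ℝ) :=
  {x ∈ stratum f e k | LinearIndependent ℝ (fun i : k.1 => differential (f i) x)}

/-- The tangent space at a regular point `x` of a stratum whose equations are
`f_i = const`, `i ∈ I`. -/
noncomputable def tangentSpaceAt (f : Fin s → MvPolynomial (Fin n) ℝ) (k : FaceIndex s)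
    (x : Fin n → ℝ) : Submodule ℝ (Fin n → ℝ) :=
  ⨅ i : k.1, LinearMap.ker (differential (f i) x)

/-- The critical points of the restriction of `h` to the regular locus of a stratum: the points
where `d_x h` vanishes on the tangent space. -/
def critSet (f : Fin s → MvPolynomial (Fin n) ℝ) (h : MvPolynomial (Fin n) ℝ) (e : Fin s → ℝ)
    (k : FaceIndex s) : Set (Fin n → ℝ) :=
  {x ∈ regStratum f e k | ∀ v ∈ tangentSpaceAt f k x, differential h x v = 0}

/-- `Σ_e`, the critical values of `h` on the regular loci of the strata of `S_e`. -/
def critValues (f : Fin s → MvPolynomial (Fin n) ℝ) (h : MvPolynomial (Fin n) ℝ)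
    (e : Fin s → ℝ) : Set ℝ :=
  ⋃ k : FaceIndex s, (fun x => eval x h) '' critSet f h e k

/-- `lim_{r → 0} A_r = ⋂_{R > 0} closure (⋃_{0 < r < R} A_r)`. -/
def limitSet (A : ℝ → Set ℝ) : Set ℝ :=
  ⋂ R ∈ Set.Ioi (0 : ℝ), closure (⋃ r ∈ Set.Ioo (0 : ℝ) R, A r)

/-! ### The algorithm -/

/-- The embedding `ℝ[x] → ℝ[x, λ]`, where there is one new variable `λ_i` for each `i ∈ I`. -/
noncomputable def incl (k : FaceIndex s) :
    MvPolynomial (Fin n) ℝ →ₐ[ℝ] MvPolynomial (Fin n ⊕ k.1) ℝ :=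
  rename Sum.inl

/-- The ideal `J'` of `ℝ[x, λ]` generated by the polynomials
`∑_{i ∈ I} λ_i ∂_j f_i - ∂_j h`, for `j = 1, …, n`, and
`σ_j e_j f_i - σ_i e_i f_j`, for `i, j ∈ I`. -/
noncomputable def lagrangeIdeal (f : Fin s → MvPolynomial (Fin n) ℝ) (h : MvPolynomial (Fin n) ℝ)
    (e : Fin s → ℝ) (k : FaceIndex s) : Ideal (MvPolynomial (Fin n ⊕ k.1) ℝ) :=
  Ideal.span (Set.range fun j : Fin n =>
      ∑ i : k.1, X (Sum.inr i) * incl k (pderiv j (f i)) - incl k (pderiv j h)) +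
    Ideal.span (Set.range fun ij : k.1 × k.1 =>
      incl k (C (k.sign ij.2 * e ij.2) * f ij.1 - C (k.sign ij.1 * e ij.1) * f ij.2))

/-- The ideal `J = J' ∩ ℝ[x] + ⟨f₁, …, f_s⟩` of `ℝ[x]`. -/
noncomputable def limitIdeal (f : Fin s → MvPolynomial (Fin n) ℝ) (h : MvPolynomial (Fin n) ℝ)
    (e : Fin s → ℝ) (k : FaceIndex s) : Ideal (MvPolynomial (Fin n) ℝ) :=
  (lagrangeIdeal f h e k).comap (incl k) + Ideal.span (Set.range f)

/-- The elimination ideal `(J + ⟨h - t⟩) ∩ ℝ[t]`, for an ideal `J` of `ℝ[x]`; here `ℝ[x, t]` is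
the ring of polynomials in `t` with coefficients in `ℝ[x]`. -/
noncomputable def valueIdeal (h : MvPolynomial (Fin n) ℝ) (J : Ideal (MvPolynomial (Fin n) ℝ)) :
    Ideal (Polynomial ℝ) :=
  (J.map Polynomial.C + Ideal.span {Polynomial.C h - Polynomial.X}).comap
    (Polynomial.mapRingHom (C : ℝ →+* MvPolynomial (Fin n) ℝ))

/-- `LoopRun f h e L Z Z'`: executing the body of the loop successively for the pairs `(I, σ)` of
the list `L`, starting with the value `Z` of the variable, can end with the value `Z'`. In each
pass, `p` may be any generator of the ideal `(J + ⟨h - t⟩) ∩ ℝ[t]`, and the set `p⁻¹(0)` of the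
real zeros of `p` is added to `Z`. -/
inductive LoopRun (f : Fin s → MvPolynomial (Fin n) ℝ) (h : MvPolynomial (Fin n) ℝ)
    (e : Fin s → ℝ) : List (FaceIndex s) → Set ℝ → Set ℝ → Prop
  | done (Z : Set ℝ) : LoopRun f h e [] Z Z
  | step (k : FaceIndex s) (L : List (FaceIndex s)) (Z Z' : Set ℝ) (p : Polynomial ℝ)
      (hp : Ideal.span {p} = valueIdeal h (limitIdeal f h e k))
      (hrest : LoopRun f h e L (Z ∪ {t | p.eval t = 0}) Z') : LoopRun f h e (k :: L) Z Z'

/-- `Z` is a possible result of the algorithm `LimitCriticalValues` on input `f₁, …, f_s, h, e`: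
starting from `Z = ∅`, the loop runs through all the pairs `(I, σ)` with `#I ≤ n`, once each and
in any order. -/
def LimitCriticalValuesReturns (f : Fin s → MvPolynomial (Fin n) ℝ) (h : MvPolynomial (Fin n) ℝ)
    (e : Fin s → ℝ) (Z : Set ℝ) : Prop :=
  ∃ L : List (FaceIndex s), L.Nodup ∧ (∀ k : FaceIndex s, k ∈ L ↔ k.1.card ≤ n) ∧
    LoopRun f h e L ∅ Z

end LimitCrit

/-!
On the zero set of `J'` one has `f_i = σ_i e_i r` for `i ∈ I` and a polynomial `r` in the `f_i`, so
the multiplier equations say `dh = ∑ λ_i df_i = (∑ λ_i σ_i e_i) dr`. In characteristic zero this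
makes `h` algebraic over `r` at every prime of the coordinate ring, hence `Q(r, h) = 0` there for
some `Q`, and dividing by powers of `r` one may take `Q(0, t) ≠ 0`. Since `r ∈ ⟨f₁, …, f_s⟩`, the
polynomial `Q(0, h)` lies in `J`, so `Q(0, t)` is a nonzero element of the elimination ideal and `Z`
is finite. Conversely, critical points on the strata of `S_{re}` are points of the zero set of `J'`
with `|f_i| ≤ r |e_i|`. By properness, if their values accumulate at `t` as `r → 0`, the points
accumulate at some point of the zero set of `J` where `h = t`.
-/

namespace LimitCrit

section Differentials

open scoped TensorProduct KaehlerDifferential Polynomial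
open KaehlerDifferential

theorem mapBaseChange_injective_of_subsingleton_h1Cotangent (R A B : Type*) [CommRing R]
    [CommRing A] [CommRing B] [Algebra R A] [Algebra R B] [Algebra A B] [IsScalarTower R A B]
    [Subsingleton (Algebra.H1Cotangent A B)] : Function.Injective (mapBaseChange R A B) := by
  refine (injective_iff_map_eq_zero _).mpr fun ω hω => ?_
  obtain ⟨y, rfl⟩ := (Algebra.H1Cotangent.exact_δ_mapBaseChange R A B ω).mp hω
  rw [Subsingleton.elim y 0, map_zero]

theorem formallySmooth_of_faithfulSMul (R K : Type*) [CommRing R] [IsDomain R] [CharZero R]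
    [Field K] [Algebra R K] [FaithfulSMul R K] [Algebra.EssFiniteType R K] :
    Algebra.FormallySmooth R K := by
  let : Algebra (FractionRing R) K := FractionRing.liftAlgebra R K
  have : IsScalarTower R (FractionRing R) K := FractionRing.isScalarTower_liftAlgebra R K
  have : Algebra.EssFiniteType (FractionRing R) K := .of_comp R _ K
  have : CharZero (FractionRing R) :=
    charZero_of_injective_algebraMap (FaithfulSMul.algebraMap_injective R _)
  have : Algebra.FormallySmooth R (FractionRing R) := .of_isLocalization (nonZeroDivisors R)
  exact .comp R (FractionRing R) K

theorem one_tmul_D_X_ne_zero (R B : Type*) [CommRing R] [CommRing B] [Nontrivial B]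
    [Algebra R B] [Algebra R[X] B] [IsScalarTower R R[X] B] :
    (1 : B) ⊗ₜ[R[X]] D R R[X] Polynomial.X ≠ 0 := fun h => by
  simpa using congrArg
    ((Polynomial.mkDerivation R (1 : B)).liftKaehlerDifferential.liftBaseChange B) h

theorem isAlgebraic_of_D_eq_zero {F K : Type*} [Field F] [CharZero F] [Field K] [Algebra F K]
    [Algebra.EssFiniteType F K] {a : K} (ha : D F K a = 0) : IsAlgebraic F a := by
  -- If `a` is transcendental, then `K` is formally smooth over `F[a]`, so that `da ≠ 0` in
  -- `K ⊗ Ω[F[a]⁄F]` stays nonzero in `Ω[K⁄F]`.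
  by_contra htrans
  let : Algebra F[X] K := (Polynomial.aeval a).toAlgebra
  have : IsScalarTower F F[X] K := .of_algebraMap_eq' (Polynomial.aeval a).comp_algebraMap.symm
  have : FaithfulSMul F[X] K :=
    (faithfulSMul_iff_algebraMap_injective _ _).mpr (transcendental_iff_injective.mp htrans)
  have : Algebra.EssFiniteType F[X] K := .of_comp F F[X] K
  have : Algebra.FormallySmooth F[X] K := formallySmooth_of_faithfulSMul F[X] K
  have hX : algebraMap F[X] K Polynomial.X = a := Polynomial.aeval_X a
  refine one_tmul_D_X_ne_zero F K
    (mapBaseChange_injective_of_subsingleton_h1Cotangent F F[X] K ?_)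
  rw [mapBaseChange_tmul, map_D, hX, ha, smul_zero, map_zero]

theorem derivation_aeval {R A M σ : Type*} [CommRing R] [CommRing A] [Algebra R A]
    [AddCommGroup M] [Module R M] [Module A M] [Fintype σ] (D : Derivation R A M) (x : σ → A)
    (p : MvPolynomial σ R) :
    D (aeval x p) = ∑ j, aeval x (pderiv j p) • D (x j) := by
  classical
  induction p using MvPolynomial.induction_on with
  | C a => simp
  | add p q hp hq => simp [hp, hq, add_smul, Finset.sum_add_distrib]
  | mul_X p i hp =>
    simp [hp, add_smul, Finset.sum_add_distrib, Finset.smul_sum, pderiv_X, Pi.single_apply,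
      smul_smul, mul_comm, ite_smul, apply_ite, add_comm]

end Differentials

section Relations

open scoped Polynomial Polynomial.Bivariate IntermediateField.algebraAdjoinAdjoin
open KaehlerDifferential
open Polynomial (evalRingHom aevalAeval)

variable {k A B K : Type*}

theorem map_aevalAeval [CommRing k] [CommRing A] [Algebra k A] [CommRing B] [Algebra k B]
    (φ : A →ₐ[k] B) (r h : A) (Q : k[X][Y]) :
    φ (aevalAeval r h Q) = aevalAeval (φ r) (φ h) Q :=
  DFunLike.congr_fun (show φ.comp (aevalAeval r h) = aevalAeval (φ r) (φ h) from
    Polynomial.algHom_ext' (by ext; simp) (by simp)) Q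

theorem aevalAeval_zero_left [CommRing k] [CommRing A] [Algebra k A] (h : A) (Q : k[X][Y]) :
    aevalAeval 0 h Q = Polynomial.aeval h (Q.map (evalRingHom 0)) :=
  DFunLike.congr_fun (show aevalAeval 0 h =
      (Polynomial.aeval h).comp (Polynomial.mapAlgHom (Polynomial.aeval (0 : k))) from
    Polynomial.algHom_ext' (by ext; simp) (by simp)) Q

theorem aevalAeval_eq_eval_map [CommRing k] [CommRing A] [Algebra k A] (r h : A) (Q : k[X][Y]) :
    aevalAeval r h Q = (Q.map (Polynomial.aeval r : k[X] →ₐ[k] A).toRingHom).eval h :=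
  DFunLike.congr_fun (show aevalAeval r h =
      ((Polynomial.aeval h).restrictScalars k).comp (Polynomial.mapAlgHom (Polynomial.aeval r)) from
    Polynomial.algHom_ext' (by ext; simp) (by simp)) Q

theorem exists_aevalAeval_eq_zero_of_isAlgebraic_adjoin [CommRing k] [CommRing A] [Algebra k A]
    {r h : A} (halg : IsAlgebraic (Algebra.adjoin k {r}) h) :
    ∃ Q : k[X][Y], Q.map (Polynomial.aeval r : k[X] →ₐ[k] A).toRingHom ≠ 0 ∧
      aevalAeval r h Q = 0 := by
  obtain ⟨q, hq, hqh⟩ := halg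
  let S := Algebra.adjoin k {r}
  have hlift : q.map (algebraMap S A) ∈
      Polynomial.lifts (Polynomial.aeval r : k[X] →ₐ[k] A).toRingHom := by
    refine (Polynomial.lifts_iff_coeff_lifts _).mpr fun i => ?_
    obtain ⟨p, hp⟩ := (Algebra.adjoin_singleton_eq_range_aeval k r).le (q.coeff i).2
    exact ⟨p, hp.trans (q.coeff_map (algebraMap S A) i).symm⟩
  obtain ⟨Q, hQ⟩ := Polynomial.mem_lifts _ |>.mp hlift
  refine ⟨Q, ?_, ?_⟩
  · rw [hQ]
    exact (Polynomial.map_ne_zero_iff Subtype.val_injective).mpr hq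
  · rw [aevalAeval_eq_eval_map, hQ, Polynomial.eval_map_algebraMap, hqh]

theorem exists_map_evalRingHom_zero_ne_zero [Field k] [CommRing A] [IsDomain A] [Algebra k A]
    {r h : A} {Q : k[X][Y]} (hQ : Q.map (Polynomial.aeval r : k[X] →ₐ[k] A).toRingHom ≠ 0)
    (hQrh : aevalAeval r h Q = 0) :
    ∃ Q' : k[X][Y], Q'.map (evalRingHom 0) ≠ 0 ∧ aevalAeval r h Q' = 0 := by
  rcases eq_or_ne r 0 with rfl | hr
  · have hspec : (Polynomial.aeval 0 : k[X] →ₐ[k] A).toRingHom =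
        (algebraMap k A).comp (evalRingHom 0) := Polynomial.ringHom_ext (by simp) (by simp)
    refine ⟨Q, fun hQ0 => hQ ?_, hQrh⟩
    rw [hspec, ← Polynomial.map_map, hQ0, Polynomial.map_zero]
  · have hX : ¬ IsUnit (Polynomial.C Polynomial.X : k[X][Y]) := by
      rw [Polynomial.isUnit_C]; exact Polynomial.not_isUnit_X
    have hQ0 : Q ≠ 0 := by rintro rfl; simp at hQ
    obtain ⟨Q', hQQ', hndvd⟩ :=
      (FiniteMultiplicity.of_not_isUnit hX hQ0).exists_eq_pow_mul_and_not_dvd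
    refine ⟨Q', fun h0 => hndvd ((Polynomial.C_dvd_iff_dvd_coeff _ _).mpr fun i => ?_), ?_⟩
    · rw [Polynomial.X_dvd_iff, Polynomial.coeff_zero_eq_eval_zero]
      simpa using congrArg (Polynomial.coeff · i) h0
    · rw [hQQ', map_mul, map_pow, Polynomial.aevalAeval_X] at hQrh
      exact (mul_eq_zero.mp hQrh).resolve_left (pow_ne_zero _ hr)

theorem D_adjoin_eq_zero_of_eq_smul_D [Field k] [Field K] [Algebra k K] {r h c : K}
    (hd : D k K h = c • D k K r) : D (IntermediateField.adjoin k {r}) K h = 0 := by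
  have hr : D (IntermediateField.adjoin k {r}) K r = 0 :=
    (D (IntermediateField.adjoin k {r}) K).map_algebraMap (IntermediateField.AdjoinSimple.gen k r)
  simpa [hr] using congrArg (KaehlerDifferential.map k (IntermediateField.adjoin k {r}) K K) hd

theorem exists_aevalAeval_eq_zero_of_D_eq_smul_D_of_field [Field k] [CharZero k] [Field K]
    [Algebra k K] [Algebra.EssFiniteType k K] {r h c : K} (hd : D k K h = c • D k K r) :
    ∃ Q : k[X][Y], Q.map (evalRingHom 0) ≠ 0 ∧ aevalAeval r h Q = 0 := by
  have : Algebra.EssFiniteType (IntermediateField.adjoin k {r}) K := .of_comp k _ K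
  have halg : IsAlgebraic (Algebra.adjoin k {r}) h :=
    (IsFractionRing.isAlgebraic_iff _ (IntermediateField.adjoin k {r}) K).mpr
      (isAlgebraic_of_D_eq_zero (D_adjoin_eq_zero_of_eq_smul_D hd))
  obtain ⟨Q, hQ, hQrh⟩ := exists_aevalAeval_eq_zero_of_isAlgebraic_adjoin halg
  exact exists_map_evalRingHom_zero_ne_zero hQ hQrh

theorem exists_aevalAeval_eq_zero_of_forall_isPrime [CommRing k] [IsDomain k] [CommRing A]
    [Algebra k A] {r h : A} (hprime : ∀ (P : Ideal A) [P.IsPrime],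
      ∃ Q : k[X][Y], Q.map (evalRingHom 0) ≠ 0 ∧ aevalAeval r h Q ∈ P) :
    ∃ Q : k[X][Y], Q.map (evalRingHom 0) ≠ 0 ∧ aevalAeval r h Q = 0 := by
  -- The `Q` with `Q(0, Y) ≠ 0` form a multiplicative set; if its image in `A` misses `0`, then it
  -- misses a prime ideal.
  let N : Ideal k[X][Y] := RingHom.ker (Polynomial.mapRingHom (evalRingHom 0))
  have : N.IsPrime := RingHom.ker_isPrime _
  by_contra! hQ
  have hdisj : Disjoint ((⊥ : Ideal A) : Set A)
      (N.primeCompl.map (aevalAeval r h : k[X][Y] →ₐ[k] A)) := by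
    rw [Set.disjoint_left]
    rintro _ rfl ⟨Q, hQN, hQ0⟩
    exact hQ Q hQN hQ0
  obtain ⟨P, _, -, hP⟩ := Ideal.exists_le_prime_disjoint _ _ hdisj
  obtain ⟨Q, hQN, hQP⟩ := hprime P
  exact Set.disjoint_left.mp hP hQP ⟨Q, hQN, rfl⟩

theorem exists_aevalAeval_eq_zero_of_D_eq_smul_D [Field k] [CharZero k] [CommRing A]
    [Algebra k A] [Algebra.EssFiniteType k A] {r h c : A} (hd : D k A h = c • D k A r) :
    ∃ Q : k[X][Y], Q.map (evalRingHom 0) ≠ 0 ∧ aevalAeval r h Q = 0 := by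
  refine exists_aevalAeval_eq_zero_of_forall_isPrime fun P _ => ?_
  let φ := IsScalarTower.toAlgHom k A P.ResidueField
  have : Algebra.EssFiniteType k P.ResidueField := .comp k A _
  have hdφ : D k P.ResidueField (φ h) = φ c • D k P.ResidueField (φ r) := by
    simpa [φ] using congrArg (KaehlerDifferential.map k k A P.ResidueField) hd
  obtain ⟨Q, hQ, hQ0⟩ := exists_aevalAeval_eq_zero_of_D_eq_smul_D_of_field hdφ
  exact ⟨Q, hQ, Ideal.algebraMap_residueField_eq_zero.mp ((map_aevalAeval φ r h Q).trans hQ0)⟩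

end Relations

section Elimination

open scoped Polynomial Polynomial.Bivariate
open Polynomial (evalRingHom aevalAeval)

theorem aeval_map_evalRingHom_zero_mem {k A : Type*} [CommRing k] [CommRing A] [Algebra k A]
    {I : Ideal A} {r h : A} {Q : k[X][Y]} (hr : r ∈ I) (hQ : aevalAeval r h Q ∈ I) :
    Polynomial.aeval h (Q.map (evalRingHom 0)) ∈ I := by
  let π := Ideal.Quotient.mkₐ k I
  have hπ (a : A) : π a = 0 ↔ a ∈ I := Ideal.Quotient.eq_zero_iff_mem
  rw [← hπ] at hr hQ ⊢
  rw [← hQ, ← Polynomial.aeval_algHom_apply, map_aevalAeval, hr, aevalAeval_zero_left]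

theorem map_C_sup_span_C_sub_X {R : Type*} [CommRing R] (J : Ideal R) (a : R) :
    J.map Polynomial.C ⊔ Ideal.span {Polynomial.C a - Polynomial.X} =
      J.comap (evalRingHom a) := by
  have hspan : Ideal.span {Polynomial.C a - Polynomial.X} = RingHom.ker (evalRingHom a) := by
    rw [Polynomial.ker_evalRingHom, ← Ideal.span_singleton_neg, neg_sub]
  have hJ : (J.map Polynomial.C).map (evalRingHom a) = J := by
    rw [Ideal.map_map]
    convert Ideal.map_id J
    ext; simp
  rw [hspan, RingHom.ker_eq_comap_bot,
    ← Ideal.comap_map_of_surjective (evalRingHom a) (Polynomial.eval_surjective a), hJ]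

theorem valueIdeal_eq_comap {n : ℕ} (h : MvPolynomial (Fin n) ℝ)
    (J : Ideal (MvPolynomial (Fin n) ℝ)) :
    valueIdeal h J = J.comap (Polynomial.aeval (R := ℝ) h) := by
  rw [valueIdeal, Submodule.add_eq_sup, map_C_sup_span_C_sub_X, Ideal.comap_comap]
  congr 1
  ext <;> simp

end Elimination

section LagrangePoints

variable {n s : ℕ} {f : Fin s → MvPolynomial (Fin n) ℝ} {h : MvPolynomial (Fin n) ℝ}
  {e : Fin s → ℝ} {k : FaceIndex s}

theorem FaceIndex.sign_ne_zero (k : FaceIndex s) (i : k.1) : k.sign i ≠ 0 := by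
  simp [FaceIndex.sign]

theorem FaceIndex.abs_sign (k : FaceIndex s) (i : k.1) : |k.sign i| = 1 := by
  rcases Int.units_eq_one_or (k.2 i) with hi | hi <;> simp [FaceIndex.sign, hi]

/-- The pair `(x, l)` is a point, with coordinates in the `ℝ`-algebra `A`, of the zero set of
`lagrangeIdeal f h e k`. Real points come from critical points, and the universal point has
coordinates in the quotient of `ℝ[x, λ]` by `lagrangeIdeal f h e k`. -/
structure IsLagrangePoint {A : Type*} [CommRing A] [Algebra ℝ A]
    (f : Fin s → MvPolynomial (Fin n) ℝ) (h : MvPolynomial (Fin n) ℝ) (e : Fin s → ℝ)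
    (k : FaceIndex s) (x : Fin n → A) (l : k.1 → A) : Prop where
  sum_mul_pderiv : ∀ j, ∑ i : k.1, l i * aeval x (pderiv j (f i)) = aeval x (pderiv j h)
  proportional : ∀ i j : k.1,
    (k.sign j * e j) • aeval x (f i) = (k.sign i * e i) • aeval x (f j)

theorem aeval_elim_incl {A : Type*} [CommRing A] [Algebra ℝ A] (x : Fin n → A) (l : k.1 → A)
    (g : MvPolynomial (Fin n) ℝ) : aeval (Sum.elim x l) (incl k g) = aeval x g := by
  rw [incl, aeval_rename, Sum.elim_comp_inl]

theorem isLagrangePoint_iff {A : Type*} [CommRing A] [Algebra ℝ A] {x : Fin n → A}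
    {l : k.1 → A} :
    IsLagrangePoint f h e k x l ↔ lagrangeIdeal f h e k ≤ RingHom.ker (aeval (Sum.elim x l)) := by
  rw [lagrangeIdeal, Submodule.add_eq_sup, sup_le_iff, Ideal.span_le, Ideal.span_le,
    Set.range_subset_iff, Set.range_subset_iff, Prod.forall]
  simp only [C_mul']
  simp only [SetLike.mem_coe, RingHom.mem_ker, map_sub, map_sum, map_mul, map_smul, aeval_X,
    Sum.elim_inr, aeval_elim_incl, sub_eq_zero]
  exact ⟨fun hx => ⟨hx.1, hx.2⟩, fun hx => ⟨hx.1, hx.2⟩⟩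

theorem IsLagrangePoint.derivation_aeval_eq_sum {A M : Type*} [CommRing A] [Algebra ℝ A]
    [AddCommGroup M] [Module ℝ M] [Module A M] {x : Fin n → A} {l : k.1 → A}
    (hx : IsLagrangePoint f h e k x l) (D : Derivation ℝ A M) :
    D (aeval x h) = ∑ i, l i • D (aeval x (f i)) := by
  simp only [derivation_aeval, ← hx.sum_mul_pderiv, Finset.sum_smul, Finset.smul_sum, mul_smul]
  exact Finset.sum_comm

/-- The parameter `r` for which `f_i = σ_i e_i r` for all `i ∈ I`, as a polynomial in `x`: the least
squares solution, which needs no choice of an index. For `I = ∅` it is `0`. -/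
noncomputable def faceParameter (f : Fin s → MvPolynomial (Fin n) ℝ) (e : Fin s → ℝ)
    (k : FaceIndex s) : MvPolynomial (Fin n) ℝ :=
  (∑ i : k.1, (k.sign i * e i) ^ 2)⁻¹ • ∑ i : k.1, (k.sign i * e i) • f i

theorem faceParameter_mem_span_range : faceParameter f e k ∈ Ideal.span (Set.range f) :=
  Submodule.smul_of_tower_mem _ _ <| sum_mem fun i _ =>
    Submodule.smul_of_tower_mem _ _ (Ideal.subset_span ⟨i, rfl⟩)

theorem IsLagrangePoint.aeval_eq_smul_faceParameter {A : Type*} [CommRing A] [Algebra ℝ A]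
    {x : Fin n → A} {l : k.1 → A} (hx : IsLagrangePoint f h e k x l) (he : ∀ i : k.1, e i ≠ 0)
    (i : k.1) : aeval x (f i) = (k.sign i * e i) • aeval x (faceParameter f e k) := by
  have hsq : ∑ j : k.1, (k.sign j * e j) ^ 2 ≠ 0 :=
    (Finset.sum_pos (fun j _ => by have := k.sign_ne_zero j; have := he j; positivity)
      ⟨i, Finset.mem_univ i⟩).ne'
  have hsum : (∑ j : k.1, (k.sign j * e j) ^ 2) • aeval x (f i) =
      (k.sign i * e i) • ∑ j : k.1, (k.sign j * e j) • aeval x (f j) := by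
    rw [Finset.sum_smul, Finset.smul_sum]
    refine Finset.sum_congr rfl fun j _ => ?_
    rw [pow_two, mul_smul, hx.proportional i j, smul_comm]
  simp only [faceParameter, map_smul, map_sum]
  rw [smul_comm, ← hsum, inv_smul_smul₀ hsq]

theorem IsLagrangePoint.exists_D_aeval_eq_smul {A : Type*} [CommRing A] [Algebra ℝ A]
    {x : Fin n → A} {l : k.1 → A} (hx : IsLagrangePoint f h e k x l) (he : ∀ i : k.1, e i ≠ 0) :
    ∃ c : A, KaehlerDifferential.D ℝ A (aeval x h) =
      c • KaehlerDifferential.D ℝ A (aeval x (faceParameter f e k)) := by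
  refine ⟨∑ i, (k.sign i * e i) • l i, ?_⟩
  simp only [hx.derivation_aeval_eq_sum, hx.aeval_eq_smul_faceParameter he, Derivation.map_smul,
    Finset.sum_smul, smul_assoc, smul_comm (l _)]

theorem isLagrangePoint_quotient_mk : IsLagrangePoint f h e k
    (fun j => Ideal.Quotient.mkₐ ℝ (lagrangeIdeal f h e k) (X (Sum.inl j)))
    (fun i => Ideal.Quotient.mkₐ ℝ (lagrangeIdeal f h e k) (X (Sum.inr i))) := by
  let π := Ideal.Quotient.mkₐ ℝ (lagrangeIdeal f h e k)
  have hπ : aeval (Sum.elim (fun j => π (X (Sum.inl j))) fun i => π (X (Sum.inr i))) = π := by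
    ext (j | i) <;> simp
  rw [isLagrangePoint_iff, hπ]
  exact (Ideal.Quotient.mkₐ_ker ℝ _).ge

open scoped Polynomial.Bivariate Polynomial in
theorem exists_aevalAeval_faceParameter_mem_lagrangeIdeal (he : ∀ i : k.1, e i ≠ 0) :
    ∃ Q : ℝ[X][Y], Q.map (Polynomial.evalRingHom 0) ≠ 0 ∧
      incl k (Polynomial.aevalAeval (faceParameter f e k) h Q) ∈ lagrangeIdeal f h e k := by
  let π := Ideal.Quotient.mkₐ ℝ (lagrangeIdeal f h e k)
  have hπ (g : MvPolynomial (Fin n) ℝ) : aeval (fun j => π (X (Sum.inl j))) g = π (incl k g) :=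
    DFunLike.congr_fun (show aeval _ = π.comp (incl k) by ext; simp [incl]) g
  obtain ⟨c, hc⟩ := (isLagrangePoint_quotient_mk (f := f) (h := h)).exists_D_aeval_eq_smul he
  obtain ⟨Q, hQ, hQ0⟩ := exists_aevalAeval_eq_zero_of_D_eq_smul_D hc
  refine ⟨Q, hQ, Ideal.Quotient.eq_zero_iff_mem.mp ?_⟩
  rwa [hπ, hπ, ← map_aevalAeval, ← map_aevalAeval] at hQ0

theorem valueIdeal_limitIdeal_ne_bot (he : ∀ i : k.1, e i ≠ 0) :
    valueIdeal h (limitIdeal f h e k) ≠ ⊥ := by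
  obtain ⟨Q, hQ, hQmem⟩ := exists_aevalAeval_faceParameter_mem_lagrangeIdeal (f := f) (h := h) he
  refine (Submodule.ne_bot_iff _).mpr ⟨Q.map (Polynomial.evalRingHom 0), ?_, hQ⟩
  rw [valueIdeal_eq_comap]
  exact aeval_map_evalRingHom_zero_mem (Ideal.mem_sup_right faceParameter_mem_span_range)
    (Ideal.mem_sup_left hQmem)

end LagrangePoints

section ClusterPoints

open Filter Topology

theorem mem_limitSet_iff_clusterPt {A : ℝ → Set ℝ} {t : ℝ} :
    t ∈ limitSet A ↔ ClusterPt t ((𝓝[>] 0).bind fun r => 𝓟 (A r)) := by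
  simp only [limitSet, Set.mem_iInter₂, clusterPt_iff_forall_mem_closure, mem_bind', mem_principal]
  constructor
  · intro ht S hS
    obtain ⟨R, hR, hRS⟩ := (nhdsGT_basis (0 : ℝ)).mem_iff.mp hS
    exact closure_mono (Set.iUnion₂_subset hRS) (ht R hR)
  · intro ht R hR
    exact ht _ ((nhdsGT_basis (0 : ℝ)).mem_iff.mpr
      ⟨R, hR, fun r hr => Set.subset_biUnion_of_mem (u := A) hr⟩)

theorem exists_clusterPt_bind_of_iUnion {α X ι : Type*} [Finite ι] [TopologicalSpace X]
    {l : Filter α} {A : α → ι → Set X} {x : X}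
    (hx : ClusterPt x (l.bind fun a => 𝓟 (⋃ i, A a i))) :
    ∃ i, ClusterPt x (l.bind fun a => 𝓟 (A a i)) := by
  simp only [clusterPt_iff_forall_mem_closure, mem_bind', mem_principal] at hx ⊢
  by_contra! hsep
  choose S hS hxS using hsep
  have hmem : x ∈ closure (⋃ i, S i) :=
    hx _ ((eventually_all.mpr hS).mono fun a ha => Set.iUnion_mono ha)
  rw [closure_iUnion_of_finite, Set.mem_iUnion] at hmem
  obtain ⟨i, hi⟩ := hmem
  exact hxS i hi

theorem mem_of_clusterPt_bind {α X : Type*} [TopologicalSpace X] {l : Filter α} {A : α → Set X}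
    {x : X} (hx : ClusterPt x (l.bind fun a => 𝓟 (A a))) {Z : Set X} (hZ : IsClosed Z)
    (hAZ : ∀ᶠ a in l, A a ⊆ Z) : x ∈ Z :=
  hZ.closure_subset (clusterPt_iff_forall_mem_closure.mp hx Z (mem_bind'.mpr hAZ))

theorem isClosed_zeroLocus {σ R K : Type*} [Field R] [Field K] [Algebra R K]
    [TopologicalSpace K] [IsTopologicalRing K] [T1Space K] (I : Ideal (MvPolynomial σ R)) :
    IsClosed (zeroLocus K I) := by
  simp only [zeroLocus, Set.ofPred_forall, aeval_def, eval₂_eq_eval_map]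
  exact isClosed_biInter fun p _ => isClosed_singleton.preimage (continuous_eval _)

theorem exists_clusterPt_of_isProperMap_domRestrict {X Y : Type*} [TopologicalSpace X]
    [TopologicalSpace Y] {g : X → Y} {S : Set X} (hg : IsProperMap (S.domRestrict g))
    {F : Filter X} (hS : S ∈ F) {y : Y} (hy : MapClusterPt y F g) :
    ∃ x, g x = y ∧ ClusterPt x F := by
  have hy' : MapClusterPt y (comap Subtype.val F) (S.domRestrict g) := by
    rwa [MapClusterPt, Set.domRestrict_eq, ← map_map, map_comap_of_mem (by rwa [Subtype.range_val])]
  obtain ⟨x, hxy, hx⟩ := hg.clusterPt_of_mapClusterPt hy'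
  exact ⟨x, hxy, hx.map continuous_subtype_val.continuousAt tendsto_comap⟩

end ClusterPoints

section CriticalPoints

open Filter Topology

variable {n s : ℕ} {f : Fin s → MvPolynomial (Fin n) ℝ} {h : MvPolynomial (Fin n) ℝ}
  {e : Fin s → ℝ} {k : FaceIndex s} {x : Fin n → ℝ}

theorem differential_apply_single (g : MvPolynomial (Fin n) ℝ) (x : Fin n → ℝ) (j : Fin n) :
    differential g x (Pi.single j 1) = eval x (pderiv j g) := by
  classical
  simp [differential, Pi.single_apply]

theorem exists_lagrange_multipliers (hx : ∀ v ∈ tangentSpaceAt f k x, differential h x v = 0) :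
    ∃ l : k.1 → ℝ, ∀ j, ∑ i, l i * eval x (pderiv j (f i)) = eval x (pderiv j h) := by
  obtain ⟨l, hl⟩ := (Submodule.mem_span_range_iff_exists_fun ℝ).mp
    (mem_span_of_iInf_ker_le_ker (L := fun i : k.1 => differential (f i) x) hx)
  refine ⟨l, fun j => ?_⟩
  simpa [differential_apply_single] using LinearMap.congr_fun hl (Pi.single j 1)

theorem exists_isLagrangePoint_of_mem_critSet {r : ℝ} (hx : x ∈ critSet f h (r • e) k) :
    ∃ l, IsLagrangePoint f h e k x l := by
  obtain ⟨⟨⟨hface, -⟩, -⟩, hcrit⟩ := hx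
  obtain ⟨l, hl⟩ := exists_lagrange_multipliers hcrit
  have hfr (i : k.1) : eval x (f i) = k.sign i * e i * r :=
    (hface i).trans (by rw [Pi.smul_apply, smul_eq_mul]; ring)
  refine ⟨l, by simpa only [← aeval_eq_eval] using hl, fun i j => ?_⟩
  simp only [aeval_eq_eval, hfr, smul_eq_mul]
  ring

theorem critSet_smul_subset_zeroLocus (r : ℝ) :
    critSet f h (r • e) k ⊆ zeroLocus ℝ ((lagrangeIdeal f h e k).comap (incl k)) := by
  intro x hx g hg
  obtain ⟨l, hl⟩ := exists_isLagrangePoint_of_mem_critSet hx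
  rw [← aeval_elim_incl x l]
  exact isLagrangePoint_iff.mp hl hg

theorem card_le_of_mem_regStratum (hx : x ∈ regStratum f e k) : k.1.card ≤ n := by
  simpa using hx.2.fintype_card_le_finrank

theorem stratum_subset_setS : stratum f e k ⊆ setS f e := by
  intro x hx i
  by_cases hi : i ∈ k.1
  · rw [hx.1 ⟨i, hi⟩, abs_mul, k.abs_sign, one_mul]
  · exact (hx.2 i hi).le

theorem critSet_subset_setS : critSet f h e k ⊆ setS f e :=
  fun _ hx => stratum_subset_setS hx.1.1

theorem abs_polyMap_le_of_mem_setS_smul {r : ℝ} (hr : 0 ≤ r) (hx : x ∈ setS f (r • e)) (i : Fin s) :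
    |polyMap f x i| ≤ r * |e i| := by
  simpa only [Pi.smul_apply, smul_eq_mul, abs_mul, abs_of_nonneg hr] using hx i

theorem setS_smul_subset {r : ℝ} (hr₀ : 0 ≤ r) (hr₁ : r ≤ 1) : setS f (r • e) ⊆ setS f e :=
  fun _ hx i => (abs_polyMap_le_of_mem_setS_smul hr₀ hx i).trans
    (mul_le_of_le_one_left (abs_nonneg _) hr₁)

theorem exists_mapClusterPt_of_mem_limitSet_critValues {t : ℝ}
    (ht : t ∈ limitSet fun r => critValues f h (r • e)) :
    ∃ k : FaceIndex s, MapClusterPt t ((𝓝[>] 0).bind fun r : ℝ => 𝓟 (critSet f h (r • e) k))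
      fun x => eval x h := by
  obtain ⟨k, hk⟩ := exists_clusterPt_bind_of_iUnion (mem_limitSet_iff_clusterPt.mp ht)
  refine ⟨k, ?_⟩
  simpa only [MapClusterPt, map_bind, Function.comp_def, map_principal] using hk

theorem setS_mem_bind_critSet :
    setS f e ∈ (𝓝[>] 0).bind fun r : ℝ => 𝓟 (critSet f h (r • e) k) := by
  rw [mem_bind']
  filter_upwards [Ioo_mem_nhdsGT one_pos] with r hr
  exact critSet_subset_setS.trans (setS_smul_subset hr.1.le hr.2.le)

theorem card_le_of_clusterPt_critSet
    (hx : ClusterPt x ((𝓝[>] 0).bind fun r : ℝ => 𝓟 (critSet f h (r • e) k))) :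
    k.1.card ≤ n := by
  by_contra hcard
  exact mem_of_clusterPt_bind hx isClosed_empty <|
    .of_forall fun r x hx => hcard (card_le_of_mem_regStratum hx.1)

theorem polyMap_eq_zero_of_clusterPt_critSet
    (hx : ClusterPt x ((𝓝[>] 0).bind fun r : ℝ => 𝓟 (critSet f h (r • e) k)))
    (i : Fin s) : polyMap f x i = 0 := by
  have hle (ε : ℝ) (hε : 0 < ε) : |polyMap f x i| ≤ ε := by
    refine mem_of_clusterPt_bind hx
      (isClosed_le (continuous_eval (f i)).abs (continuous_const (y := ε))) ?_
    have hlim : Tendsto (fun r => r * |e i|) (𝓝[>] 0) (𝓝 0) :=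
      ((continuous_mul_const |e i|).tendsto' 0 0 (zero_mul _)).mono_left nhdsWithin_le_nhds
    filter_upwards [hlim.eventually (Iic_mem_nhds hε), self_mem_nhdsWithin] with r hrε hr x hx
    exact (abs_polyMap_le_of_mem_setS_smul (le_of_lt hr) (critSet_subset_setS hx) i).trans hrε
  exact abs_nonpos_iff.mp (le_of_forall_pos_le_add (by simpa using hle))

theorem mem_zeroLocus_limitIdeal_of_clusterPt_critSet
    (hx : ClusterPt x ((𝓝[>] 0).bind fun r : ℝ => 𝓟 (critSet f h (r • e) k))) :
    x ∈ zeroLocus ℝ (limitIdeal f h e k) := by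
  have hJ : (lagrangeIdeal f h e k).comap (incl k) ≤ RingHom.ker (aeval x) :=
    mem_of_clusterPt_bind hx (isClosed_zeroLocus _) (.of_forall critSet_smul_subset_zeroLocus)
  have hf : Ideal.span (Set.range f) ≤ RingHom.ker (aeval x) := by
    rw [Ideal.span_le, Set.range_subset_iff]
    exact polyMap_eq_zero_of_clusterPt_critSet hx
  exact sup_le hJ hf

end CriticalPoints

section Algorithm

variable {n s : ℕ} {f : Fin s → MvPolynomial (Fin n) ℝ} {h : MvPolynomial (Fin n) ℝ}
  {e : Fin s → ℝ} {k : FaceIndex s}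

/-- The real zeros of the elimination ideal that the algorithm computes for the pair `k`: the set
that it adds to `Z`, whatever generator it chooses. -/
def limitValues (f : Fin s → MvPolynomial (Fin n) ℝ) (h : MvPolynomial (Fin n) ℝ)
    (e : Fin s → ℝ) (k : FaceIndex s) : Set ℝ :=
  {t | ∀ p ∈ valueIdeal h (limitIdeal f h e k), p.eval t = 0}

theorem finite_setOf_forall_eval_eq_zero {R : Type*} [CommRing R] [IsDomain R]
    {I : Ideal (Polynomial R)} (hI : I ≠ ⊥) : {t | ∀ p ∈ I, p.eval t = 0}.Finite := by
  obtain ⟨p, hp, hp0⟩ := (Submodule.ne_bot_iff I).mp hI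
  exact (Polynomial.finite_setOfPred_isRoot hp0).subset fun t ht => ht p hp

theorem limitValues_finite (he : ∀ i : k.1, e i ≠ 0) : (limitValues f h e k).Finite :=
  finite_setOf_forall_eval_eq_zero (valueIdeal_limitIdeal_ne_bot he)

theorem setOf_eval_eq_zero_of_span_singleton_eq {p : Polynomial ℝ}
    (hp : Ideal.span {p} = valueIdeal h (limitIdeal f h e k)) :
    {t | p.eval t = 0} = limitValues f h e k := by
  ext t
  refine ⟨fun ht q hq => ?_, fun ht => ht p (hp ▸ Ideal.mem_span_singleton_self p)⟩
  rw [← hp, Ideal.mem_span_singleton] at hq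
  exact Polynomial.eval_eq_zero_of_dvd_of_eval_eq_zero hq ht

theorem eval_mem_limitValues {x : Fin n → ℝ} (hx : x ∈ zeroLocus ℝ (limitIdeal f h e k)) :
    eval x h ∈ limitValues f h e k := by
  intro p hp
  rw [valueIdeal_eq_comap, Ideal.mem_comap] at hp
  rw [← hx _ hp, ← Polynomial.aeval_algHom_apply, Polynomial.coe_aeval_eq_eval, aeval_eq_eval]

theorem loopRun_iff {L : List (FaceIndex s)} {Z Z' : Set ℝ} :
    LoopRun f h e L Z Z' ↔ Z' = Z ∪ ⋃ k ∈ L, limitValues f h e k := by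
  have hcons (k : FaceIndex s) (L : List (FaceIndex s)) (Z : Set ℝ) :
      Z ∪ ⋃ k' ∈ k :: L, limitValues f h e k' =
        Z ∪ limitValues f h e k ∪ ⋃ k' ∈ L, limitValues f h e k' := by
    simp only [List.mem_cons, Set.iUnion_or, Set.iUnion_union_distrib, Set.iUnion_iUnion_eq_left,
      Set.union_assoc]
  constructor
  · intro hrun
    induction hrun with
    | done Z => simp
    | step k L Z _ p hp _ ih => rw [ih, hcons, setOf_eval_eq_zero_of_span_singleton_eq hp]
  · rintro rfl
    induction L generalizing Z with
    | nil => simpa using LoopRun.done Z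
    | cons k L ih =>
      obtain ⟨p, hp⟩ := (IsPrincipalIdealRing.principal
        (valueIdeal h (limitIdeal f h e k))).principal
      refine .step k L Z _ p hp.symm ?_
      rw [hcons, setOf_eval_eq_zero_of_span_singleton_eq hp.symm]
      exact ih

theorem limitCriticalValuesReturns_iff {Z : Set ℝ} :
    LimitCriticalValuesReturns f h e Z ↔
      Z = ⋃ k ∈ {k : FaceIndex s | k.1.card ≤ n}, limitValues f h e k := by
  classical
  simp only [LimitCriticalValuesReturns, loopRun_iff, Set.empty_union, Set.mem_ofPred_eq]
  constructor
  · rintro ⟨L, -, hL, rfl⟩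
    simp only [hL]
  · rintro rfl
    let L := (Finset.univ.filter fun k : FaceIndex s => k.1.card ≤ n).toList
    have hL (k : FaceIndex s) : k ∈ L ↔ k.1.card ≤ n := by simp [L]
    exact ⟨L, Finset.nodup_toList _, hL, by simp only [hL]⟩

theorem limitSet_critValues_subset
    (hproper : IsProperMap ((setS f e).domRestrict fun x => eval x h)) :
    limitSet (fun r => critValues f h (r • e)) ⊆
      ⋃ k ∈ {k : FaceIndex s | k.1.card ≤ n}, limitValues f h e k := by
  intro t ht
  obtain ⟨k, hk⟩ := exists_mapClusterPt_of_mem_limitSet_critValues ht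
  obtain ⟨x, rfl, hx⟩ :=
    exists_clusterPt_of_isProperMap_domRestrict hproper setS_mem_bind_critSet hk
  exact Set.mem_biUnion (card_le_of_clusterPt_critSet hx)
    (eval_mem_limitValues (mem_zeroLocus_limitIdeal_of_clusterPt_critSet hx))

end Algorithm

end LimitCrit

theorem mainTheorem9 (n s : ℕ) (f : Fin s → MvPolynomial (Fin n) ℝ) (h : MvPolynomial (Fin n) ℝ)
    (e : Fin s → ℝ) (he : ∀ i, e i ≠ 0)
    (hproper : IsProperMap (fun x : LimitCrit.setS f e => MvPolynomial.eval (x : Fin n → ℝ) h)) :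
    (∃ Z : Set ℝ, LimitCrit.LimitCriticalValuesReturns f h e Z) ∧
    ∀ Z : Set ℝ, LimitCrit.LimitCriticalValuesReturns f h e Z →
      Z.Finite ∧ LimitCrit.limitSet (fun r : ℝ => LimitCrit.critValues f h (r • e)) ⊆ Z := by
  simp only [LimitCrit.limitCriticalValuesReturns_iff, exists_eq, forall_eq, true_and]
  exact ⟨Set.toFinite _ |>.biUnion fun k _ => LimitCrit.limitValues_finite fun i => he i,
    LimitCrit.limitSet_critValues_subset hproper⟩
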